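/- Let $N, L \ge 1$ be integers, $p \ge 0$ (transmit power), $\alpha_s \ge 0$, let $\mathbf h_s \in \mathbb C^N$ (the sensing channel vector) and let $\mathbf w \in \mathbb C^N$ with $\|\mathbf w\|^2 = 1$ (the beamformer). On a probability space let $\mathbf s$ be a (possibly deterministic) random vector in $\mathbb C^L$ with $L^{-1}\|\mathbf s\|^2 = 1$ almost surely, let $\beta \sim \mathcal{CN}(0,\alpha_s)$, and let $\mathbf N_s$ be a random matrix in $\mathbb C^{N\times L}$ with i.i.d. $\mathcal{CN}(0,1)$ entries, with $\mathbf s$, $\beta$, $\mathbf N_s$ mutually independent. Here $\mathcal{CN}(0,v)$ denotes the circularly-symmetric complex Gaussian law of variance $v$. Put $$\mathbf X = \sqrt p\,\mathbf w\,\mathbf s^{\mathsf H} \in \mathbb C^{N\times L}, \qquad \mathbf G = \beta\,\mathbf h_s\mathbf h_s^{\mathsf T}, \qquad \mathbf Y_s = \mathbf G\mathbf X + \mathbf N_s .$$ Let $I(\mathbf Y_s;\beta\mid\mathbf X)$ be the conditional mutual information in bits, i.e. $\frac{1}{\ln 2}$ times the average over the law of $\mathbf X$ of the Kullback–Leibler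 divergence (in nats) of the conditional law of $(\mathbf Y_s,\beta)$ given $\mathbf X$ from the product of the conditional laws of $\mathbf Y_s$ and of $\beta$ given $\mathbf X$. Then the downlink sensing rate $\mathcal R_{d,s} = L^{-1} I(\mathbf Y_s;\beta\mid\mathbf X)$ is finite and $$\mathcal R_{d,s} = \frac1L\log_2\!\left(1 + pL\alpha_s\|\mathbf h_s\|^2\,|\mathbf h_s^{\mathsf T}\mathbf w|^2\right).$$ -/

import Mathlib

open MeasureTheory ProbabilityTheory InformationTheory Matrix
open scoped ENNReal NNReal

noncomputable section

namespace ISAC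

/-- The circularly-symmetric complex Gaussian law `CN(0, v)` on `ℂ`: the real and imaginary parts are
independent real Gaussians with mean `0` and variance `v / 2` each. -/
def complexGaussian (v : ℝ≥0) : Measure ℂ :=
  ((gaussianReal 0 (v / 2)).prod (gaussianReal 0 (v / 2))).map Complex.measurableEquivRealProd.symm

/-- The matrix space `ℂ^{m × n}` carries the product σ-algebra. -/
instance matrixMeasurableSpace (m n : ℕ) : MeasurableSpace (Matrix (Fin m) (Fin n) ℂ) :=
  inferInstanceAs (MeasurableSpace (Fin m → Fin n → ℂ))

instance matrixStandardBorel (m n : ℕ) : StandardBorelSpace (Matrix (Fin m) (Fin n) ℂ) :=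
  inferInstanceAs (StandardBorelSpace (Fin m → Fin n → ℂ))

/-- Conditional mutual information `I(U; V | Z)` in bits, with values in `[0, ∞]`: the average over
the law of `Z` of the Kullback-Leibler divergence (in nats) of the conditional joint law of `(U, V)`
given `Z = z` from the product of the conditional laws of `U` and of `V` given `Z = z`,
divided by `log 2`. -/
def condMutualInfo {Ω 𝒰 𝒱 𝒵 : Type*} [MeasurableSpace Ω]
    [MeasurableSpace 𝒰] [StandardBorelSpace 𝒰] [Nonempty 𝒰]
    [MeasurableSpace 𝒱] [StandardBorelSpace 𝒱] [Nonempty 𝒱] [MeasurableSpace 𝒵]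
    (U : Ω → 𝒰) (V : Ω → 𝒱) (Z : Ω → 𝒵) (μ : Measure Ω) [IsFiniteMeasure μ] : ℝ≥0∞ :=
  (∫⁻ z, klDiv (condDistrib (fun ω => (U ω, V ω)) Z μ z)
      ((condDistrib U Z μ z).prod (condDistrib V Z μ z)) ∂(μ.map Z)) / ENNReal.ofReal (Real.log 2)

/-- The transmitted signal matrix `X = √p w sᴴ ∈ ℂ^{N × L}`. -/
def signal {N L : ℕ} (p : ℝ) (w : EuclideanSpace ℂ (Fin N)) (s : EuclideanSpace ℂ (Fin L)) :
    Matrix (Fin N) (Fin L) ℂ :=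
  (Real.sqrt p : ℂ) • vecMulVec w.ofLp (star s.ofLp)

/-- The target response matrix `G = β h hᵀ ∈ ℂ^{N × N}`. -/
def targetResponse {N : ℕ} (h : EuclideanSpace ℂ (Fin N)) (β : ℂ) : Matrix (Fin N) (Fin N) ℂ :=
  β • vecMulVec h.ofLp h.ofLp

/-- The received echo `Y = G X + N`, where `G` is the target response matrix and `N` the noise. -/
def echo {N L : ℕ} (h : EuclideanSpace ℂ (Fin N)) (β : ℂ) (X W : Matrix (Fin N) (Fin L) ℂ) :
    Matrix (Fin N) (Fin L) ℂ :=
  targetResponse h β * X + W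

/-- The downlink sensing rate `L⁻¹ I(Y; β | X)` (bits per unit time), for the random data stream `s`,
the random target amplitude `β` and the random noise matrix `W`. -/
def sensingRate {Ω : Type*} [MeasurableSpace Ω] {N L : ℕ} (μ : Measure Ω) [IsFiniteMeasure μ]
    (p : ℝ) (h w : EuclideanSpace ℂ (Fin N)) (s : Ω → EuclideanSpace ℂ (Fin L)) (β : Ω → ℂ)
    (W : Ω → Matrix (Fin N) (Fin L) ℂ) : ℝ≥0∞ :=
  (L : ℝ≥0∞)⁻¹ *
    condMutualInfo (fun ω => echo h (β ω) (signal p w (s ω)) (W ω)) β (fun ω => signal p w (s ω)) μ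

end ISAC

end

/-!
For a fixed signal matrix `x` the echo is `Y = β B + W` with `B = h hᵀ x`. Translating white
Gaussian noise by `A` multiplies its law by `exp (2 Re ⟨A, y⟩ - ‖A‖²)`, so the likelihood of `β`
depends on the observation only through the matched filter `T y = ⟨B, y⟩`, and `T Y = c β + T W`
with `c = ‖B‖²`. Since every likelihood integrates to `1`, the Laplace transform of `T W` is that
of `CN(0, c)`; hence the channel carries the same information as the scalar channel
`β ↦ c β + CN(0, c)`. Averaging the likelihood over `β ∼ CN(0, α)` gives the information density
in closed form: it is `log (1 + α c)` plus a quadratic expression in `β` and `T Y` of mean zero.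
By independence, conditioning on `X = x` only freezes the signal, and as `h hᵀ X` has rank one,
`c = p ‖s‖² ‖h‖² |hᵀ w|²`.
-/

namespace ISAC

open Real
open scoped RealInnerProductSpace Matrix.Norms.Frobenius

section Density

variable {α β : Type*} [MeasurableSpace α] [MeasurableSpace β]

theorem map_withDensity_comp {μ : Measure α} {g : α → β} (hg : Measurable g) {f : β → ℝ≥0∞}
    (hf : Measurable f) : (μ.withDensity (f ∘ g)).map g = (μ.map g).withDensity f := by
  ext s hs
  rw [Measure.map_apply hg hs, withDensity_apply _ (hg hs), withDensity_apply _ hs,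
    setLIntegral_map hs hf hg]
  rfl

theorem map_fst_prod_withDensity {μ : Measure α} {ν : Measure β} [SFinite μ] [SFinite ν]
    {f : α × β → ℝ≥0∞} (hf : Measurable f) :
    ((μ.prod ν).withDensity f).map Prod.fst = μ.withDensity fun x => ∫⁻ y, f (x, y) ∂ν := by
  ext s hs
  rw [Measure.map_apply measurable_fst hs, withDensity_apply _ (measurable_fst hs),
    withDensity_apply _ hs, ← Set.prod_univ, ← Measure.prod_restrict, Measure.restrict_univ,
    lintegral_prod _ hf.aemeasurable]

theorem lintegral_pi_prod {ι : Type*} [Fintype ι] {X : ι → Type*} [∀ i, MeasurableSpace (X i)]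
    (μ : ∀ i, Measure (X i)) [∀ i, SigmaFinite (μ i)] {f : ∀ i, X i → ℝ≥0∞}
    (hf : ∀ i, Measurable (f i)) :
    ∫⁻ x, ∏ i, f i (x i) ∂Measure.pi μ = ∏ i, ∫⁻ x, f i x ∂μ i := by
  classical
  have marginal : ∀ (s : Finset ι) (x : ∀ i, X i),
      (∫⋯∫⁻_s, (fun y => ∏ i ∈ s, f i (y i)) ∂μ) x = ∏ i ∈ s, ∫⁻ z, f i z ∂μ i := by
    intro s
    induction s using Finset.induction_on with
    | empty => simp
    | insert i s hi ih =>
      intro x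
      have hprod : ∀ y : ∀ j, X j, ∫⁻ z, ∏ j ∈ insert i s, f j (Function.update y i z j) ∂μ i =
          (∫⁻ z, f i z ∂μ i) * ∏ j ∈ s, f j (y j) := by
        intro y
        rw [← lintegral_mul_const _ (hf i)]
        refine lintegral_congr fun z => ?_
        rw [Finset.prod_insert hi, Function.update_self]
        congr 1
        refine Finset.prod_congr rfl fun j hj => ?_
        rw [Function.update_of_ne (ne_of_mem_of_not_mem hj hi)]
      rw [lmarginal_insert' _ (by fun_prop) hi, Finset.prod_insert hi, ← ih x]
      simp_rw [hprod]
      exact lintegral_const_mul _ (by fun_prop)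
  obtain hempty | ⟨⟨x⟩⟩ := isEmpty_or_nonempty (∀ i, X i)
  · obtain ⟨i, hi⟩ := isEmpty_pi.1 hempty
    have hμi : ∫⁻ x, f i x ∂μ i = 0 := by
      rw [Measure.eq_zero_of_isEmpty (μ i), lintegral_zero_measure]
    rw [Measure.eq_zero_of_isEmpty (Measure.pi μ), lintegral_zero_measure,
      Finset.prod_eq_zero (Finset.mem_univ i) hμi]
  · exact (lintegral_eq_lmarginal_univ x).trans (marginal Finset.univ x)

theorem pi_withDensity {ι : Type*} [Fintype ι] {X : ι → Type*} [∀ i, MeasurableSpace (X i)]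
    (μ : ∀ i, Measure (X i)) [∀ i, SigmaFinite (μ i)] {f : ∀ i, X i → ℝ≥0∞}
    (hf : ∀ i, Measurable (f i)) [∀ i, SigmaFinite ((μ i).withDensity (f i))] :
    Measure.pi (fun i => (μ i).withDensity (f i)) =
      (Measure.pi μ).withDensity fun x => ∏ i, f i (x i) := by
  refine Measure.pi_eq fun s hs => ?_
  rw [withDensity_apply _ (MeasurableSet.univ_pi hs), Measure.restrict_pi_pi,
    lintegral_pi_prod _ hf]
  exact Finset.prod_congr rfl fun i _ => (withDensity_apply _ (hs i)).symm

theorem klDiv_withDensity_exp {μ : Measure α} [IsProbabilityMeasure μ] {i : α → ℝ}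
    (hi : Measurable i)
    [IsProbabilityMeasure (μ.withDensity fun x => ENNReal.ofReal (exp (i x)))]
    (hint : Integrable i (μ.withDensity fun x => ENNReal.ofReal (exp (i x)))) :
    klDiv (μ.withDensity fun x => ENNReal.ofReal (exp (i x))) μ =
      ENNReal.ofReal (∫ x, i x ∂μ.withDensity fun x => ENNReal.ofReal (exp (i x))) := by
  set ν := μ.withDensity fun x => ENNReal.ofReal (exp (i x)) with hν
  have hac : ν ≪ μ := withDensity_absolutelyContinuous _ _
  have hllr : llr ν μ =ᵐ[ν] i := by
    filter_upwards [hac.ae_le (Measure.rnDeriv_withDensity μ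
      (f := fun x => ENNReal.ofReal (exp (i x))) (by fun_prop))] with x hx
    rw [llr, hν, hx, ENNReal.toReal_ofReal (exp_pos _).le, log_exp]
  rw [klDiv_of_ac_of_integrable hac ((integrable_congr hllr).2 hint), integral_congr_ae hllr]
  simp

end Density

theorem ext_of_integral_exp_inner {E : Type*} [NormedAddCommGroup E] [InnerProductSpace ℝ E]
    [CompleteSpace E] [MeasurableSpace E] [BorelSpace E] [SecondCountableTopology E]
    {μ ν : Measure E} [IsFiniteMeasure μ] [IsFiniteMeasure ν]
    (hμ : ∀ a : E, Integrable (fun x => exp ⟪a, x⟫) μ)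
    (h : ∀ a : E, ∫ x, exp ⟪a, x⟫ ∂μ = ∫ x, exp ⟪a, x⟫ ∂ν) : μ = ν := by
  have hmass : μ = 0 ↔ ν = 0 := by
    have h0 : μ.real Set.univ = ν.real Set.univ := by simpa using h 0
    rw [← Measure.measure_univ_eq_zero, ← measureReal_eq_zero_iff, h0, measureReal_eq_zero_iff,
      Measure.measure_univ_eq_zero]
  refine Measure.ext_of_charFun (funext fun a => ?_)
  have hmgf : mgf (fun x => ⟪x, a⟫) μ = mgf (fun x => ⟪x, a⟫) ν := by
    ext t
    simpa only [mgf, real_inner_smul_left, real_inner_comm a] using h (t • a)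
  have hset : integrableExpSet (fun x => ⟪x, a⟫) μ = Set.univ := by
    refine Set.eq_univ_of_forall fun t => ?_
    change Integrable (fun x => exp (t * ⟪x, a⟫)) μ
    simpa only [real_inner_smul_left, real_inner_comm a] using hμ (t • a)
  have hcomplex := eqOn_complexMGF_of_mgf' hmgf hmass (x := Complex.I) (by simp [hset])
  simpa only [complexMGF, charFun, mul_comm Complex.I] using hcomplex

section Gaussian

variable {v : ℝ≥0}

theorem gaussianReal_map_add_const_eq_withDensity (hv : v ≠ 0) (m a : ℝ) :
    (gaussianReal m v).map (· + a) = (gaussianReal m v).withDensity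
      fun x => ENNReal.ofReal (exp ((a * (x - m) - a ^ 2 / 2) / v)) := by
  have hv' : (v : ℝ) ≠ 0 := NNReal.coe_ne_zero.2 hv
  rw [gaussianReal_map_add_const, gaussianReal_of_var_ne_zero _ hv,
    gaussianReal_of_var_ne_zero _ hv,
    ← withDensity_mul _ (measurable_gaussianPDF m v) (by fun_prop)]
  congr 1
  ext x
  rw [Pi.mul_apply, gaussianPDF, gaussianPDF, ← ENNReal.ofReal_mul (gaussianPDFReal_nonneg _ _ _),
    gaussianPDFReal, gaussianPDFReal, mul_assoc _⁻¹, ← exp_add]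
  congr 3
  field_simp
  ring

theorem gaussianPDFReal_mul_exp_quadratic (hv : v ≠ 0) (c : ℝ≥0) (t x : ℝ) :
    gaussianPDFReal 0 v x * exp (t * x - c * x ^ 2 / 2) =
      ((√(1 + v * c))⁻¹ * exp (v * t ^ 2 / (2 * (1 + v * c)))) *
        gaussianPDFReal (v * t / (1 + v * c)) (v / (1 + v * c)) x := by
  have hv' : (v : ℝ) ≠ 0 := NNReal.coe_ne_zero.2 hv
  have hsqrt : √(2 * π * (v / (1 + v * c))) = √(2 * π * v) / √(1 + v * c) := by
    rw [← mul_div_assoc, sqrt_div (by positivity)]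
  have hnormalization : (√(1 + v * c))⁻¹ * (√(1 + v * c) / √(2 * π * v)) = (√(2 * π * v))⁻¹ := by
    field_simp
  simp only [gaussianPDFReal]
  push_cast
  rw [hsqrt, inv_div, mul_mul_mul_comm, hnormalization, mul_assoc, ← exp_add, ← exp_add]
  congr 2
  field_simp
  ring

theorem lintegral_exp_quadratic_gaussianReal (v c : ℝ≥0) (t : ℝ) :
    ∫⁻ x, ENNReal.ofReal (exp (t * x - c * x ^ 2 / 2)) ∂gaussianReal 0 v =
      ENNReal.ofReal ((√(1 + v * c))⁻¹ * exp (v * t ^ 2 / (2 * (1 + v * c)))) := by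
  obtain rfl | hv := eq_or_ne v 0
  · simp
  have hcompleteSquare : ∀ x, gaussianPDF 0 v x * ENNReal.ofReal (exp (t * x - c * x ^ 2 / 2)) =
      ENNReal.ofReal ((√(1 + v * c))⁻¹ * exp (v * t ^ 2 / (2 * (1 + v * c)))) *
        gaussianPDF (v * t / (1 + v * c)) (v / (1 + v * c)) x := fun x => by
    rw [gaussianPDF, gaussianPDF, ← ENNReal.ofReal_mul (gaussianPDFReal_nonneg _ _ _),
      ← ENNReal.ofReal_mul (by positivity), gaussianPDFReal_mul_exp_quadratic hv]
  rw [gaussianReal_of_var_ne_zero _ hv, lintegral_withDensity_eq_lintegral_mul _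
    (measurable_gaussianPDF _ _) (by fun_prop)]
  simp only [Pi.mul_apply, hcompleteSquare]
  rw [lintegral_const_mul _ (measurable_gaussianPDF _ _),
    lintegral_gaussianPDF_eq_one _ (by positivity), mul_one]

instance isProbabilityMeasure_complexGaussian : IsProbabilityMeasure (complexGaussian v) :=
  Measure.isProbabilityMeasure_map (by fun_prop)

theorem hasLaw_re_complexGaussian :
    HasLaw Complex.re (gaussianReal 0 (v / 2)) (complexGaussian v) where
  map_eq := by
    rw [complexGaussian, Measure.map_map (by fun_prop) (by fun_prop)]
    exact (measurePreserving_fst (μ := gaussianReal 0 (v / 2))).map_eq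

theorem hasLaw_im_complexGaussian :
    HasLaw Complex.im (gaussianReal 0 (v / 2)) (complexGaussian v) where
  map_eq := by
    rw [complexGaussian, Measure.map_map (by fun_prop) (by fun_prop)]
    exact (measurePreserving_snd (ν := gaussianReal 0 (v / 2))).map_eq

theorem inner_complex_eq_re_mul_re_add_im_mul_im (a z : ℂ) :
    ⟪a, z⟫ = a.re * z.re + a.im * z.im := by
  simp [Complex.inner, mul_comm]

theorem sq_norm_eq_sq_re_add_sq_im (z : ℂ) : ‖z‖ ^ 2 = z.re ^ 2 + z.im ^ 2 := by
  rw [Complex.sq_norm, Complex.normSq_apply, sq, sq]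

theorem complexGaussian_map_add_const_eq_withDensity (hv : v ≠ 0) (a : ℂ) :
    (complexGaussian v).map (· + a) = (complexGaussian v).withDensity
      fun z => ENNReal.ofReal (exp ((2 * ⟪a, z⟫ - ‖a‖ ^ 2) / v)) := by
  have hv2 : v / 2 ≠ 0 := by positivity
  have htranslate : (· + a) ∘ Complex.measurableEquivRealProd.symm =
      Complex.measurableEquivRealProd.symm ∘ Prod.map (· + a.re) (· + a.im) := rfl
  rw [complexGaussian, Measure.map_map (by fun_prop) (by fun_prop), htranslate,
    ← Measure.map_map (by fun_prop) (by fun_prop),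
    ← Measure.map_prod_map _ _ (by fun_prop) (by fun_prop),
    gaussianReal_map_add_const_eq_withDensity hv2, gaussianReal_map_add_const_eq_withDensity hv2,
    prod_withDensity (by fun_prop) (by fun_prop),
    ← map_withDensity_comp (by fun_prop) (by fun_prop)]
  congr 2
  ext q
  rw [← ENNReal.ofReal_mul (by positivity), ← exp_add]
  simp only [Function.comp_apply, inner_complex_eq_re_mul_re_add_im_mul_im,
    sq_norm_eq_sq_re_add_sq_im, Complex.measurableEquivRealProd_symm_apply]
  push_cast
  congr 2
  field_simp
  ring

theorem lintegral_exp_quadratic_complexGaussian (v c : ℝ≥0) (a : ℂ) :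
    ∫⁻ z, ENNReal.ofReal (exp (2 * ⟪a, z⟫ - c * ‖z‖ ^ 2)) ∂complexGaussian v =
      ENNReal.ofReal ((1 + v * c : ℝ)⁻¹ * exp (v * ‖a‖ ^ 2 / (1 + v * c))) := by
  have hfactor : ∀ q : ℝ × ℝ, ENNReal.ofReal (exp
      (2 * ⟪a, Complex.measurableEquivRealProd.symm q⟫ -
        c * ‖Complex.measurableEquivRealProd.symm q‖ ^ 2)) =
      ENNReal.ofReal (exp (2 * a.re * q.1 - (2 * c : ℝ≥0) * q.1 ^ 2 / 2)) *
        ENNReal.ofReal (exp (2 * a.im * q.2 - (2 * c : ℝ≥0) * q.2 ^ 2 / 2)) := by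
    intro q
    rw [← ENNReal.ofReal_mul (by positivity), ← exp_add]
    simp only [inner_complex_eq_re_mul_re_add_im_mul_im, sq_norm_eq_sq_re_add_sq_im,
      Complex.measurableEquivRealProd_symm_apply]
    push_cast
    ring_nf
  rw [complexGaussian, lintegral_map (by fun_prop) (by fun_prop)]
  simp only [hfactor]
  rw [lintegral_prod_mul
    (f := fun x => ENNReal.ofReal (exp (2 * a.re * x - (2 * c : ℝ≥0) * x ^ 2 / 2)))
    (g := fun y => ENNReal.ofReal (exp (2 * a.im * y - (2 * c : ℝ≥0) * y ^ 2 / 2)))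
    (by fun_prop) (by fun_prop), lintegral_exp_quadratic_gaussianReal,
    lintegral_exp_quadratic_gaussianReal, ← ENNReal.ofReal_mul (by positivity), mul_mul_mul_comm,
    ← exp_add]
  have hgain : ((v / 2 : ℝ≥0) : ℝ) * ((2 * c : ℝ≥0) : ℝ) = v * c := by
    push_cast
    ring
  rw [hgain, ← mul_inv, mul_self_sqrt (by positivity), sq_norm_eq_sq_re_add_sq_im]
  congr 3
  push_cast
  field_simp

theorem pi_complexGaussian_map_add_const_eq_withDensity {ι : Type*} [Fintype ι] (hv : v ≠ 0)
    (a : ι → ℂ) :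
    (Measure.pi fun _ : ι => complexGaussian v).map (· + a) =
      (Measure.pi fun _ : ι => complexGaussian v).withDensity
        fun z => ENNReal.ofReal (exp ((2 * ∑ i, ⟪a i, z i⟫ - ∑ i, ‖a i‖ ^ 2) / v)) := by
  have hpi : (Measure.pi fun _ : ι => complexGaussian v).map (· + a) =
      Measure.pi fun i => (complexGaussian v).map (· + a i) :=
    Measure.pi_map_pi (f := fun i z => z + a i) (fun i => by fun_prop)
  rw [hpi]
  simp only [complexGaussian_map_add_const_eq_withDensity hv]
  rw [pi_withDensity _ (fun i => by fun_prop)]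
  simp only [← ENNReal.ofReal_prod_of_nonneg (fun _ _ => (exp_pos _).le), ← exp_sum, Finset.mul_sum,
    ← Finset.sum_div, Finset.sum_sub_distrib]

theorem memLp_id_complexGaussian {p : ℝ≥0∞} (hp : p ≠ ∞) : MemLp id p (complexGaussian v) := by
  have hre := hasLaw_re_complexGaussian (v := v)
  have him := hasLaw_im_complexGaussian (v := v)
  refine memLp_re_im_iff.1 ⟨?_, ?_⟩
  · refine (memLp_map_measure_iff (g := id) ?_ hre.aemeasurable).1 ?_
    · fun_prop
    · exact hre.map_eq ▸ memLp_id_gaussianReal' p hp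
  · refine (memLp_map_measure_iff (g := id) ?_ him.aemeasurable).1 ?_
    · fun_prop
    · exact him.map_eq ▸ memLp_id_gaussianReal' p hp

theorem integral_id_complexGaussian : ∫ z, z ∂complexGaussian v = 0 := by
  have hint : Integrable (fun z => z) (complexGaussian v) :=
    (memLp_id_complexGaussian ENNReal.one_ne_top).integrable le_rfl
  apply Complex.ext
  · rw [← RCLike.re_eq_complex_re, ← integral_re hint]
    simpa using (hasLaw_re_complexGaussian (v := v)).integral_eq
  · rw [← RCLike.im_eq_complex_im, ← integral_im hint]
    simpa using (hasLaw_im_complexGaussian (v := v)).integral_eq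

theorem integral_norm_sq_complexGaussian : ∫ z, ‖z‖ ^ 2 ∂complexGaussian v = v := by
  have hLp : MemLp (fun z => z) 2 (complexGaussian v) :=
    memLp_id_complexGaussian ENNReal.ofNat_ne_top
  have hsecondMoment : ∫ x, x ^ 2 ∂gaussianReal 0 (v / 2) = v / 2 := by
    simpa [variance_eq_integral aemeasurable_id] using
      variance_id_gaussianReal (μ := 0) (v := v / 2)
  have hre : ∫ z, z.re ^ 2 ∂complexGaussian v = v / 2 := by
    rw [← hsecondMoment]
    exact hasLaw_re_complexGaussian.integral_comp (f := fun x => x ^ 2) (by fun_prop)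
  have him : ∫ z, z.im ^ 2 ∂complexGaussian v = v / 2 := by
    rw [← hsecondMoment]
    exact hasLaw_im_complexGaussian.integral_comp (f := fun x => x ^ 2) (by fun_prop)
  calc ∫ z, ‖z‖ ^ 2 ∂complexGaussian v
      = ∫ z, (z.re ^ 2 + z.im ^ 2) ∂complexGaussian v := by
        simp only [sq_norm_eq_sq_re_add_sq_im]
    _ = ∫ z, z.re ^ 2 ∂complexGaussian v + ∫ z, z.im ^ 2 ∂complexGaussian v :=
        integral_add hLp.re.integrable_sq hLp.im.integrable_sq
    _ = v := by rw [hre, him, add_halves]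

theorem eq_complexGaussian_of_lintegral_exp_inner {μ : Measure ℂ}
    (h : ∀ a : ℂ, ∫⁻ z, ENNReal.ofReal (exp (2 * ⟪a, z⟫)) ∂μ = ENNReal.ofReal (exp (v * ‖a‖ ^ 2))) :
    μ = complexGaussian v := by
  have hgaussian : ∀ a : ℂ, ∫⁻ z, ENNReal.ofReal (exp (2 * ⟪a, z⟫)) ∂complexGaussian v =
      ENNReal.ofReal (exp (v * ‖a‖ ^ 2)) := fun a => by
    simpa using lintegral_exp_quadratic_complexGaussian v 0 a
  have hrescale : ∀ a z : ℂ, ⟪a, z⟫ = 2 * ⟪(2⁻¹ : ℝ) • a, z⟫ := fun a z => by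
    rw [real_inner_smul_left, mul_inv_cancel_left₀ two_ne_zero]
  have hfinite : IsFiniteMeasure μ := ⟨by simpa using (h 0).trans_lt ENNReal.ofReal_lt_top⟩
  refine ext_of_integral_exp_inner (fun a => ⟨by fun_prop, ?_⟩) fun a => ?_
  · rw [hasFiniteIntegral_iff_ofReal (.of_forall fun _ => (exp_pos _).le)]
    simp_rw [hrescale a, h, ENNReal.ofReal_lt_top]
  · rw [integral_eq_lintegral_of_nonneg_ae (.of_forall fun _ => (exp_pos _).le) (by fun_prop),
      integral_eq_lintegral_of_nonneg_ae (.of_forall fun _ => (exp_pos _).le) (by fun_prop)]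
    simp_rw [hrescale a, h, hgaussian]

end Gaussian

section Information

variable {α c : ℝ≥0}

/-- The logarithm of the density of the joint law of input and output of a Gaussian channel of gain
`c` with input law `CN(0, α)`, relative to the product of its marginals. It is a function of the
input `b` and the matched filter output `t`. -/
noncomputable def infoDensity (α c : ℝ≥0) (t b : ℂ) : ℝ :=
  log (1 + α * c) + (2 * ⟪b, t⟫ - c * ‖b‖ ^ 2) - α * ‖t‖ ^ 2 / (1 + α * c)

@[fun_prop]
theorem measurable_infoDensity {E : Type*} [MeasurableSpace E] {t b : E → ℂ} (ht : Measurable t)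
    (hb : Measurable b) : Measurable fun x => infoDensity α c (t x) (b x) := by
  unfold infoDensity
  fun_prop

theorem infoDensity_smul_add (b t : ℂ) :
    infoDensity α c ((c : ℝ) • b + t) b =
      log (1 + α * c) + (1 + α * c : ℝ)⁻¹ * (c * ‖b‖ ^ 2 + 2 * ⟪b, t⟫ - α * ‖t‖ ^ 2) := by
  rw [infoDensity, norm_add_sq_real, inner_add_right, real_inner_smul_right, real_inner_smul_left,
    real_inner_self_eq_norm_sq, norm_smul, Real.norm_of_nonneg c.coe_nonneg]
  field_simp
  ring

theorem integrable_norm_sq_complexGaussian : Integrable (fun z => ‖z‖ ^ 2) (complexGaussian α) :=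
  (memLp_id_complexGaussian ENNReal.ofNat_ne_top).integrable_norm_pow two_ne_zero

theorem integrable_inner_complexGaussian_prod :
    Integrable (fun q : ℂ × ℂ => ⟪q.1, q.2⟫) ((complexGaussian α).prod (complexGaussian c)) :=
  ((memLp_id_complexGaussian ENNReal.one_ne_top).integrable le_rfl).op_fst_snd continuous_inner
    ⟨1, fun x y => by simpa using norm_inner_le_norm (𝕜 := ℝ) x y⟩
    ((memLp_id_complexGaussian ENNReal.one_ne_top).integrable le_rfl)

theorem integral_inner_complexGaussian_prod :
    ∫ q : ℂ × ℂ, ⟪q.1, q.2⟫ ∂(complexGaussian α).prod (complexGaussian c) = 0 := by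
  have hint : Integrable (fun z => z) (complexGaussian c) :=
    (memLp_id_complexGaussian ENNReal.one_ne_top).integrable le_rfl
  rw [integral_prod _ integrable_inner_complexGaussian_prod]
  simp_rw [integral_inner hint, integral_id_complexGaussian, inner_zero_right, integral_zero]

theorem integrable_sq_add_inner_complexGaussian_prod (r : ℝ) :
    Integrable (fun q : ℂ × ℂ => r * ‖q.1‖ ^ 2 + 2 * ⟪q.1, q.2⟫)
      ((complexGaussian α).prod (complexGaussian c)) :=
  ((integrable_norm_sq_complexGaussian.comp_fst _).const_mul r).add
    (integrable_inner_complexGaussian_prod.const_mul 2)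

theorem integral_sq_add_inner_complexGaussian_prod (r : ℝ) :
    ∫ q : ℂ × ℂ, (r * ‖q.1‖ ^ 2 + 2 * ⟪q.1, q.2⟫)
      ∂(complexGaussian α).prod (complexGaussian c) = r * α := by
  rw [integral_add ((integrable_norm_sq_complexGaussian.comp_fst _).const_mul r)
      (integrable_inner_complexGaussian_prod.const_mul 2), integral_const_mul, integral_const_mul,
    integral_inner_complexGaussian_prod, integral_fun_fst (fun z : ℂ => ‖z‖ ^ 2),
    integral_norm_sq_complexGaussian]
  simp

theorem integrable_infoDensity_smul_add :
    Integrable (fun q : ℂ × ℂ => infoDensity α c ((c : ℝ) • q.1 + q.2) q.1)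
      ((complexGaussian α).prod (complexGaussian c)) := by
  simp only [infoDensity_smul_add]
  exact (integrable_const _).add (((integrable_sq_add_inner_complexGaussian_prod c).sub
    ((integrable_norm_sq_complexGaussian.comp_snd _).const_mul _)).const_mul _)

theorem integral_infoDensity_smul_add :
    ∫ q : ℂ × ℂ, infoDensity α c ((c : ℝ) • q.1 + q.2) q.1
      ∂(complexGaussian α).prod (complexGaussian c) = log (1 + α * c) := by
  have hsignal := integrable_sq_add_inner_complexGaussian_prod (α := α) (c := c) c
  have hnoise := ((integrable_norm_sq_complexGaussian (α := c)).comp_snd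
    (complexGaussian α)).const_mul (α : ℝ)
  have hexcess : Integrable (fun q : ℂ × ℂ => c * ‖q.1‖ ^ 2 + 2 * ⟪q.1, q.2⟫ - α * ‖q.2‖ ^ 2)
      ((complexGaussian α).prod (complexGaussian c)) := hsignal.sub hnoise
  simp only [infoDensity_smul_add]
  rw [integral_add (integrable_const _) (hexcess.const_mul _), integral_const_mul,
    integral_sub hsignal hnoise, integral_const_mul, integral_sq_add_inner_complexGaussian_prod,
    integral_fun_snd (fun z : ℂ => ‖z‖ ^ 2), integral_norm_sq_complexGaussian]
  simp [mul_comm]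

end Information

/-- A channel with input `b : ℂ` and noise `y` of law `ν`, whose output `φ (b, y)` depends on `b`
like that of an additive Gaussian channel of gain `c`: an input changes the law of the noise by an
exponential tilt in a sufficient statistic `T` (the matched filter), and shifts `T` by `c b`. -/
structure IsGaussianChannel {E : Type*} [MeasurableSpace E] (φ : ℂ × E → E) (T : E → ℂ)
    (ν : Measure E) (c : ℝ≥0) : Prop where
  measurable_channel : Measurable φ
  measurable_filter : Measurable T
  map_eq_withDensity : ∀ b, ν.map (fun y => φ (b, y)) =
    ν.withDensity fun y => ENNReal.ofReal (exp (2 * ⟪b, T y⟫ - c * ‖b‖ ^ 2))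
  filter_channel : ∀ b y, T (φ (b, y)) = (c : ℝ) • b + T y

namespace IsGaussianChannel

variable {E : Type*} [MeasurableSpace E] {φ : ℂ × E → E} {T : E → ℂ} {ν : Measure E}
  {c : ℝ≥0}

theorem map_prodMk_fst_eq_withDensity [SFinite ν] (hφ : IsGaussianChannel φ T ν c)
    (γ : Measure ℂ) [SFinite γ] :
    (γ.prod ν).map (fun q => (φ q, q.1)) = (ν.prod γ).withDensity fun q =>
      ENNReal.ofReal (exp (2 * ⟪q.2, T q.1⟫ - c * ‖q.2‖ ^ 2)) := by
  have hT := hφ.measurable_filter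
  have hφm := hφ.measurable_channel
  refine Measure.ext_of_lintegral _ fun f hf => ?_
  rw [lintegral_map hf (by fun_prop), lintegral_withDensity_eq_lintegral_mul _ (by fun_prop) hf,
    lintegral_prod _ (by fun_prop), lintegral_prod_symm _ (by fun_prop)]
  refine lintegral_congr fun b => ?_
  rw [← lintegral_map (f := fun y => f (y, b)) (by fun_prop) (by fun_prop),
    hφ.map_eq_withDensity b, lintegral_withDensity_eq_lintegral_mul _ (by fun_prop) (by fun_prop)]
  rfl

variable [IsProbabilityMeasure ν]

theorem hasLaw_filter (hφ : IsGaussianChannel φ T ν c) : HasLaw T (complexGaussian c) ν where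
  aemeasurable := hφ.measurable_filter.aemeasurable
  map_eq := by
    have hT := hφ.measurable_filter
    refine eq_complexGaussian_of_lintegral_exp_inner fun a => ?_
    have hφa : Measurable fun y => φ (a, y) := hφ.measurable_channel.comp measurable_prodMk_left
    have hmass : ∫⁻ y, ENNReal.ofReal (exp (2 * ⟪a, T y⟫ - c * ‖a‖ ^ 2)) ∂ν = 1 := by
      rw [← setLIntegral_univ, ← withDensity_apply _ MeasurableSet.univ, ← hφ.map_eq_withDensity,
        Measure.map_apply hφa MeasurableSet.univ, Set.preimage_univ, measure_univ]
    calc ∫⁻ z, ENNReal.ofReal (exp (2 * ⟪a, z⟫)) ∂ν.map T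
        = ∫⁻ y, ENNReal.ofReal (exp (2 * ⟪a, T y⟫)) ∂ν := lintegral_map (by fun_prop) hT
      _ = ∫⁻ y, ENNReal.ofReal (exp (c * ‖a‖ ^ 2)) *
            ENNReal.ofReal (exp (2 * ⟪a, T y⟫ - c * ‖a‖ ^ 2)) ∂ν := by
          refine lintegral_congr fun y => ?_
          rw [← ENNReal.ofReal_mul (exp_pos _).le, ← exp_add, add_sub_cancel]
      _ = ENNReal.ofReal (exp (c * ‖a‖ ^ 2)) := by
          rw [lintegral_const_mul _ (by fun_prop), hmass, mul_one]

theorem map_complexGaussian_eq_withDensity (hφ : IsGaussianChannel φ T ν c) (α : ℝ≥0) :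
    ((complexGaussian α).prod ν).map φ = ν.withDensity fun y =>
      ENNReal.ofReal ((1 + α * c : ℝ)⁻¹ * exp (α * ‖T y‖ ^ 2 / (1 + α * c))) := by
  have hT := hφ.measurable_filter
  have hφm := hφ.measurable_channel
  have hfst : ((complexGaussian α).prod ν).map φ =
      (((complexGaussian α).prod ν).map fun q => (φ q, q.1)).map Prod.fst := by
    rw [Measure.map_map measurable_fst (by fun_prop)]
    rfl
  rw [hfst, hφ.map_prodMk_fst_eq_withDensity, map_fst_prod_withDensity (by fun_prop)]
  simp only [lintegral_exp_quadratic_complexGaussian, real_inner_comm (T _)]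

theorem map_prodMk_fst_eq_withDensity_infoDensity (hφ : IsGaussianChannel φ T ν c) (α : ℝ≥0) :
    ((complexGaussian α).prod ν).map (fun q => (φ q, q.1)) =
      ((((complexGaussian α).prod ν).map φ).prod (complexGaussian α)).withDensity fun q =>
        ENNReal.ofReal (exp (infoDensity α c (T q.1) q.2)) := by
  have hT := hφ.measurable_filter
  rw [hφ.map_prodMk_fst_eq_withDensity, hφ.map_complexGaussian_eq_withDensity,
    prod_withDensity_left (by fun_prop),
    ← withDensity_mul _ (by fun_prop) (by fun_prop)]
  congr 1
  ext q
  rw [Pi.mul_apply, ← ENNReal.ofReal_mul (by positivity), mul_assoc, ← exp_add, infoDensity,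
    add_sub_assoc, add_left_comm, exp_add (log _), exp_log (by positivity),
    inv_mul_cancel_left₀ (by positivity), add_sub_cancel]

theorem hasLaw_prodMk_filter (hφ : IsGaussianChannel φ T ν c) (γ : Measure ℂ) [SFinite γ] :
    HasLaw (fun q : ℂ × E => (q.1, T q.2)) (γ.prod (complexGaussian c)) (γ.prod ν) where
  aemeasurable := by
    have hT := hφ.measurable_filter
    fun_prop
  map_eq := by
    have hprod := Measure.map_prod_map γ ν measurable_id hφ.measurable_filter
    rw [Measure.map_id, hφ.hasLaw_filter.map_eq] at hprod
    exact hprod.symm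

theorem integrable_infoDensity (hφ : IsGaussianChannel φ T ν c) (α : ℝ≥0) :
    Integrable (fun q : E × ℂ => infoDensity α c (T q.1) q.2)
      (((complexGaussian α).prod ν).map fun q => (φ q, q.1)) := by
  have hT := hφ.measurable_filter
  have hφm := hφ.measurable_channel
  rw [integrable_map_measure (Measurable.aestronglyMeasurable (by fun_prop)) (by fun_prop)]
  simp only [Function.comp_def, hφ.filter_channel]
  have hlaw := hφ.hasLaw_prodMk_filter (complexGaussian α)
  have hint := integrable_infoDensity_smul_add (α := α) (c := c)
  rw [← hlaw.map_eq] at hint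
  exact hint.comp_aemeasurable hlaw.aemeasurable

theorem integral_infoDensity (hφ : IsGaussianChannel φ T ν c) (α : ℝ≥0) :
    ∫ q : E × ℂ, infoDensity α c (T q.1) q.2
      ∂((complexGaussian α).prod ν).map (fun q => (φ q, q.1)) = log (1 + α * c) := by
  have hT := hφ.measurable_filter
  have hφm := hφ.measurable_channel
  rw [integral_map (by fun_prop) (Measurable.aestronglyMeasurable (by fun_prop)),
    ← integral_infoDensity_smul_add]
  simp only [hφ.filter_channel]
  exact (hφ.hasLaw_prodMk_filter (complexGaussian α)).integral_comp
    (f := fun q => infoDensity α c ((c : ℝ) • q.1 + q.2) q.1)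
    (Measurable.aestronglyMeasurable (by fun_prop))

theorem klDiv_eq (hφ : IsGaussianChannel φ T ν c) (α : ℝ≥0) :
    klDiv (((complexGaussian α).prod ν).map fun q => (φ q, q.1))
      ((((complexGaussian α).prod ν).map φ).prod (complexGaussian α)) =
      ENNReal.ofReal (log (1 + α * c)) := by
  have hT := hφ.measurable_filter
  have hφm := hφ.measurable_channel
  have hdensity := hφ.map_prodMk_fst_eq_withDensity_infoDensity α
  have : IsProbabilityMeasure (((complexGaussian α).prod ν).map φ) :=
    Measure.isProbabilityMeasure_map hφm.aemeasurable
  have hjoint : IsProbabilityMeasure (((complexGaussian α).prod ν).map fun q => (φ q, q.1)) :=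
    Measure.isProbabilityMeasure_map (by fun_prop)
  have hintegrable := hφ.integrable_infoDensity α
  rw [← hφ.integral_infoDensity α]
  rw [hdensity] at hjoint hintegrable ⊢
  exact klDiv_withDensity_exp (by fun_prop) hintegrable

end IsGaussianChannel

section ConditionalLaw

variable {Ω 𝒵 𝒱 𝒰 : Type*} [MeasurableSpace Ω] [MeasurableSpace 𝒵] [MeasurableSpace 𝒱]
  [MeasurableSpace 𝒰] {μ : Measure Ω}

theorem indepFun_prodMk_right {U : Ω → 𝒰} {V : Ω → 𝒱} {Z : Ω → 𝒵} [IsFiniteMeasure μ]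
    (hU : AEMeasurable U μ) (hV : AEMeasurable V μ) (hZ : AEMeasurable Z μ)
    (hUV : IndepFun U V μ) (hUVZ : IndepFun (fun ω => (U ω, V ω)) Z μ) :
    IndepFun U (fun ω => (V ω, Z ω)) μ := by
  have hVZ : IndepFun V Z μ := hUVZ.comp measurable_snd measurable_id
  rw [indepFun_iff_map_prod_eq_prod_map_map hU (hV.prodMk hZ),
    hVZ.map_prod_eq_prod_map_map hV hZ, ← Measure.prodAssoc_prod,
    ← hUV.map_prod_eq_prod_map_map hU hV, ← hUVZ.map_prod_eq_prod_map_map (hU.prodMk hV) hZ,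
    AEMeasurable.map_map_of_aemeasurable (by fun_prop) ((hU.prodMk hV).prodMk hZ)]
  rfl

variable [IsFiniteMeasure μ] {Z : Ω → 𝒵} {V : Ω → 𝒱} {γ : Measure 𝒱} [IsProbabilityMeasure γ]

theorem condDistrib_ae_eq_map_of_indepFun [StandardBorelSpace 𝒰] [Nonempty 𝒰]
    (hZ : AEMeasurable Z μ) (hV : HasLaw V γ μ) (hZV : IndepFun Z V μ)
    {f : 𝒵 × 𝒱 → 𝒰} (hf : Measurable f) :
    ∀ᵐ z ∂(μ.map Z), condDistrib (fun ω => f (Z ω, V ω)) Z μ z = γ.map fun v => f (z, v) := by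
  let κ : Kernel 𝒵 𝒰 := (Kernel.id ×ₖ Kernel.const 𝒵 γ).map f
  have hκ : ∀ z, κ z = γ.map fun v => f (z, v) := fun z => by
    rw [Kernel.map_apply _ hf, Kernel.prod_apply, Kernel.id_apply, Kernel.const_apply,
      Measure.dirac_prod, Measure.map_map hf (by fun_prop)]
    rfl
  have : IsMarkovKernel κ := Kernel.IsMarkovKernel.map _ hf
  have hjoint : μ.map (fun ω => (Z ω, f (Z ω, V ω))) = μ.map Z ⊗ₘ κ := by
    have hpair : μ.map (fun ω => (Z ω, f (Z ω, V ω))) =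
        ((μ.map Z).prod γ).map fun q => (q.1, f q) := by
      rw [← hV.map_eq, ← hZV.map_prod_eq_prod_map_map hZ hV.aemeasurable,
        AEMeasurable.map_map_of_aemeasurable (by fun_prop) (hZ.prodMk hV.aemeasurable)]
      rfl
    refine Measure.ext_of_lintegral _ fun g hg => ?_
    rw [hpair, lintegral_map hg (by fun_prop), lintegral_prod _ (by fun_prop),
      Measure.lintegral_compProd hg]
    refine lintegral_congr fun z => ?_
    rw [hκ, lintegral_map (f := fun u => g (z, u)) (by fun_prop) (by fun_prop)]
  filter_upwards [condDistrib_ae_eq_of_measure_eq_compProd Z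
    (hf.comp_aemeasurable (hZ.prodMk hV.aemeasurable)) hjoint] with z hz
  rw [← hκ, ← hz]
  rfl

theorem condMutualInfo_of_indepFun [StandardBorelSpace 𝒰] [Nonempty 𝒰] {𝒯 : Type*}
    [MeasurableSpace 𝒯] [StandardBorelSpace 𝒯] [Nonempty 𝒯]
    (hZ : AEMeasurable Z μ) (hV : HasLaw V γ μ) (hZV : IndepFun Z V μ)
    {f : 𝒵 × 𝒱 → 𝒰} (hf : Measurable f) {g : 𝒱 → 𝒯} (hg : Measurable g) :
    condMutualInfo (fun ω => f (Z ω, V ω)) (fun ω => g (V ω)) Z μ =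
      (∫⁻ z, klDiv (γ.map fun v => (f (z, v), g v)) ((γ.map fun v => f (z, v)).prod (γ.map g))
        ∂(μ.map Z)) / ENNReal.ofReal (log 2) := by
  rw [condMutualInfo]
  congr 1
  refine lintegral_congr_ae ?_
  filter_upwards [
    condDistrib_ae_eq_map_of_indepFun hZ hV hZV (hf.prodMk (hg.comp measurable_snd)),
    condDistrib_ae_eq_map_of_indepFun hZ hV hZV hf,
    condDistrib_ae_eq_map_of_indepFun hZ hV hZV (hg.comp measurable_snd)] with z hjoint hU hT
  simp only [Function.comp_apply] at hjoint hT
  rw [hjoint, hU, hT]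

end ConditionalLaw

section GaussianMatrix

variable {N L : ℕ}

instance borelSpace_matrix : BorelSpace (Matrix (Fin N) (Fin L) ℂ) :=
  inferInstanceAs (BorelSpace (Fin N → Fin L → ℂ))

instance secondCountableTopology_matrix : SecondCountableTopology (Matrix (Fin N) (Fin L) ℂ) :=
  inferInstanceAs (SecondCountableTopology (Fin N → Fin L → ℂ))

theorem sq_frobenius_norm_eq_sum (A : Matrix (Fin N) (Fin L) ℂ) :
    ‖A‖ ^ 2 = ∑ i, ∑ l, ‖A i l‖ ^ 2 := by
  rw [Matrix.frobenius_norm_def, ← sqrt_eq_rpow, sq_sqrt (by positivity)]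
  simp only [rpow_two]

theorem re_trace_conjTranspose_mul_eq_sum_inner (A B : Matrix (Fin N) (Fin L) ℂ) :
    (Aᴴ * B).trace.re = ∑ i, ∑ l, ⟪A i l, B i l⟫ := by
  rw [Finset.sum_comm]
  simp only [Matrix.trace, Matrix.diag_apply, Matrix.mul_apply, Matrix.conjTranspose_apply,
    Complex.re_sum, Complex.inner, RCLike.star_def, mul_comm]

theorem trace_conjTranspose_mul_self_eq_sq_norm (A : Matrix (Fin N) (Fin L) ℂ) :
    (Aᴴ * A).trace = (‖A‖ ^ 2 : ℝ) := by
  rw [sq_frobenius_norm_eq_sum, Finset.sum_comm]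
  simp only [Matrix.trace, Matrix.diag_apply, Matrix.mul_apply, Matrix.conjTranspose_apply,
    RCLike.star_def, Complex.conj_mul', Complex.ofReal_sum, Complex.ofReal_pow]

theorem frobenius_norm_vecMulVec (u : EuclideanSpace ℂ (Fin N)) (v : EuclideanSpace ℂ (Fin L)) :
    ‖vecMulVec u.ofLp v.ofLp‖ = ‖u‖ * ‖v‖ := by
  rw [← sq_eq_sq₀ (by positivity) (by positivity), sq_frobenius_norm_eq_sum, mul_pow,
    EuclideanSpace.norm_sq_eq, EuclideanSpace.norm_sq_eq, Finset.sum_mul_sum]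
  simp only [vecMulVec_apply, norm_mul, mul_pow]

/-- The law of an `N × L` complex matrix with independent `CN(0, 1)` entries: the white noise of the
receiver. -/
noncomputable def gaussianMatrix (N L : ℕ) : Measure (Matrix (Fin N) (Fin L) ℂ) :=
  (Measure.pi fun _ : Fin N × Fin L => complexGaussian 1).map fun z => Matrix.of fun i l => z (i, l)

instance isProbabilityMeasure_gaussianMatrix : IsProbabilityMeasure (gaussianMatrix N L) :=
  Measure.isProbabilityMeasure_map (Continuous.aemeasurable (by fun_prop))

theorem hasLaw_gaussianMatrix {Ω : Type*} [MeasurableSpace Ω] {μ : Measure Ω}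
    {W : Ω → Matrix (Fin N) (Fin L) ℂ}
    (hW : ∀ i l, HasLaw (fun ω => W ω i l) (complexGaussian 1) μ)
    (hW_indep : iIndepFun (fun (il : Fin N × Fin L) ω => W ω il.1 il.2) μ) :
    HasLaw W (gaussianMatrix N L) μ :=
  HasLaw.comp (Y := fun z : Fin N × Fin L → ℂ => Matrix.of fun i l => z (i, l))
    ⟨Continuous.aemeasurable (by fun_prop), rfl⟩ (hW_indep.hasLaw_pi fun il => hW il.1 il.2)

theorem gaussianMatrix_map_const_add_eq_withDensity (A : Matrix (Fin N) (Fin L) ℂ) :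
    (gaussianMatrix N L).map (A + ·) = (gaussianMatrix N L).withDensity
      fun y => ENNReal.ofReal (exp (2 * (Aᴴ * y).trace.re - ‖A‖ ^ 2)) := by
  have htranslate : (A + ·) ∘ (fun z : Fin N × Fin L → ℂ => Matrix.of fun i l => z (i, l)) =
      (fun z => Matrix.of fun i l => z (i, l)) ∘ (· + fun q => A q.1 q.2) := by
    ext z i l
    exact add_comm _ _
  have hof : Measurable fun z : Fin N × Fin L → ℂ => Matrix.of fun i l => z (i, l) :=
    Continuous.measurable (by fun_prop)
  rw [gaussianMatrix, Measure.map_map (Continuous.measurable (by fun_prop)) hof, htranslate,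
    ← Measure.map_map hof (by fun_prop),
    pi_complexGaussian_map_add_const_eq_withDensity one_ne_zero,
    ← map_withDensity_comp hof (Continuous.measurable (by fun_prop)).ennreal_ofReal]
  congr 2
  ext z
  simp only [Function.comp_apply, re_trace_conjTranspose_mul_eq_sum_inner, sq_frobenius_norm_eq_sum,
    Fintype.sum_prod_type, Matrix.of_apply, NNReal.coe_one, div_one]

end GaussianMatrix

section Echo

variable {N L : ℕ}

theorem continuous_signal (p : ℝ) (w : EuclideanSpace ℂ (Fin N)) :
    Continuous (signal (L := L) p w) := by
  unfold signal
  fun_prop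

theorem continuous_echo (h : EuclideanSpace ℂ (Fin N)) :
    Continuous fun q : Matrix (Fin N) (Fin L) ℂ × ℂ × Matrix (Fin N) (Fin L) ℂ =>
      echo h q.2.1 q.1 q.2.2 := by
  unfold echo targetResponse
  fun_prop

theorem norm_vecMulVec_mul_signal_sq {p : ℝ} (hp : 0 ≤ p) (h w : EuclideanSpace ℂ (Fin N))
    (s : EuclideanSpace ℂ (Fin L)) :
    ‖vecMulVec h.ofLp h.ofLp * signal p w s‖ ^ 2 =
      p * ‖s‖ ^ 2 * ‖h‖ ^ 2 * ‖h.ofLp ⬝ᵥ w.ofLp‖ ^ 2 := by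
  have hrankOne : ‖vecMulVec h.ofLp (star s.ofLp)‖ = ‖h‖ * ‖s‖ := by
    have hstar : ‖WithLp.toLp 2 (star s.ofLp)‖ = ‖s‖ := by simp [EuclideanSpace.norm_eq]
    rw [← hstar]
    exact frobenius_norm_vecMulVec h (WithLp.toLp 2 (star s.ofLp))
  rw [signal, Matrix.mul_smul, vecMulVec_mul_vecMulVec, vecMulVec_smul, norm_smul, norm_smul,
    hrankOne, Complex.norm_real, norm_of_nonneg (sqrt_nonneg p)]
  simp only [mul_pow, sq_sqrt hp]
  ring

theorem isGaussianChannel_echo (h : EuclideanSpace ℂ (Fin N)) (x : Matrix (Fin N) (Fin L) ℂ) :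
    IsGaussianChannel (fun q => echo h q.1 x q.2)
      (fun y => ((vecMulVec h.ofLp h.ofLp * x)ᴴ * y).trace) (gaussianMatrix N L)
      (‖vecMulVec h.ofLp h.ofLp * x‖₊ ^ 2) where
  measurable_channel :=
    ((continuous_echo h).comp (f := fun q => (x, q)) (by fun_prop)).measurable
  measurable_filter := Continuous.measurable (by fun_prop)
  map_eq_withDensity b := by
    simp only [echo, targetResponse, Matrix.smul_mul]
    rw [gaussianMatrix_map_const_add_eq_withDensity]
    congr 1
    ext y
    rw [Matrix.conjTranspose_smul, Matrix.smul_mul, Matrix.trace_smul, norm_smul, mul_pow,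
      mul_comm (‖b‖ ^ 2), Complex.inner, smul_eq_mul, RCLike.star_def, mul_comm (starRingEnd ℂ b),
      NNReal.coe_pow, coe_nnnorm]
  filter_channel b y := by
    rw [echo, targetResponse, Matrix.smul_mul, Matrix.mul_add, Matrix.mul_smul, Matrix.trace_add,
      Matrix.trace_smul, trace_conjTranspose_mul_self_eq_sq_norm, smul_eq_mul, mul_comm]
    simp

end Echo

theorem condMutualInfo_echo {Ω : Type*} [MeasurableSpace Ω] {μ : Measure Ω} [IsFiniteMeasure μ]
    {N L : ℕ} (h : EuclideanSpace ℂ (Fin N)) {α : ℝ≥0} {X W : Ω → Matrix (Fin N) (Fin L) ℂ}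
    {β : Ω → ℂ} (hX : AEMeasurable X μ)
    (hβW : HasLaw (fun ω => (β ω, W ω)) ((complexGaussian α).prod (gaussianMatrix N L)) μ)
    (hind : IndepFun X (fun ω => (β ω, W ω)) μ) :
    condMutualInfo (fun ω => echo h (β ω) (X ω) (W ω)) β X μ =
      ∫⁻ ω, ENNReal.ofReal (logb 2 (1 + α * ‖vecMulVec h.ofLp h.ofLp * X ω‖ ^ 2)) ∂μ := by
  have hinput : ((complexGaussian α).prod (gaussianMatrix N L)).map Prod.fst = complexGaussian α :=
    measurePreserving_fst.map_eq
  have hgain : Measurable fun x : Matrix (Fin N) (Fin L) ℂ => ‖vecMulVec h.ofLp h.ofLp * x‖ :=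
    Continuous.measurable (by fun_prop)
  have hlogb : Measurable fun t : ℝ => ENNReal.ofReal (logb 2 (1 + α * t ^ 2)) := by
    unfold logb
    fun_prop
  calc condMutualInfo (fun ω => echo h (β ω) (X ω) (W ω)) β X μ
      = (∫⁻ x, ENNReal.ofReal (log (1 + α * ‖vecMulVec h.ofLp h.ofLp * x‖ ^ 2)) ∂μ.map X) /
          ENNReal.ofReal (log 2) := by
        have hcond := condMutualInfo_of_indepFun hX hβW hind
          (f := fun q => echo h q.2.1 q.1 q.2.2) (continuous_echo h).measurable measurable_fst
        rw [hinput] at hcond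
        refine hcond.trans ?_
        congr 1
        refine lintegral_congr fun x => ?_
        exact (isGaussianChannel_echo h x).klDiv_eq α
    _ = ∫⁻ x, ENNReal.ofReal (logb 2 (1 + α * ‖vecMulVec h.ofLp h.ofLp * x‖ ^ 2)) ∂μ.map X := by
        simp only [logb, ENNReal.ofReal_div_of_pos (log_pos one_lt_two)]
        simp only [div_eq_mul_inv]
        rw [lintegral_mul_const' _ _ (by simp [log_pos one_lt_two])]
    _ = ∫⁻ ω, ENNReal.ofReal (logb 2 (1 + α * ‖vecMulVec h.ofLp h.ofLp * X ω‖ ^ 2)) ∂μ :=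
        lintegral_map' (hlogb.comp hgain).aemeasurable hX

theorem inv_mul_lintegral_comp_sq_norm_of_unit_power {Ω : Type*} [MeasurableSpace Ω]
    {μ : Measure Ω} [IsProbabilityMeasure μ] {L : ℕ} {s : Ω → EuclideanSpace ℂ (Fin L)}
    (hs : ∀ᵐ ω ∂μ, (L : ℝ)⁻¹ * ‖s ω‖ ^ 2 = 1) (f : ℝ → ℝ) :
    (L : ℝ≥0∞)⁻¹ * ∫⁻ ω, ENNReal.ofReal (f (‖s ω‖ ^ 2)) ∂μ = ENNReal.ofReal (1 / L * f L) := by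
  have hL : (L : ℝ) ≠ 0 := by
    intro h0
    obtain ⟨ω, hω⟩ := hs.exists
    simp [h0] at hω
  have hpower : ∀ᵐ ω ∂μ, ENNReal.ofReal (f (‖s ω‖ ^ 2)) = ENNReal.ofReal (f L) := by
    filter_upwards [hs] with ω hω
    rw [(inv_mul_eq_one₀ hL).1 hω]
  rw [lintegral_congr_ae hpower, lintegral_const, measure_univ, mul_one,
    ENNReal.ofReal_mul (by positivity), one_div, ENNReal.ofReal_inv_of_pos (by positivity),
    ENNReal.ofReal_natCast]

end ISAC

open scoped Matrix.Norms.Frobenius in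
theorem lemma1_general {Ω : Type*} [MeasurableSpace Ω] (μ : Measure Ω) [IsProbabilityMeasure μ]
    {N L : ℕ} (p : ℝ) (hp : 0 ≤ p) (αs : ℝ≥0) (h w : EuclideanSpace ℂ (Fin N))
    (s : Ω → EuclideanSpace ℂ (Fin L)) (hs_meas : AEMeasurable s μ)
    (β : Ω → ℂ) (hβ : HasLaw β (ISAC.complexGaussian αs) μ)
    (W : Ω → Matrix (Fin N) (Fin L) ℂ)
    (hW : ∀ i l, HasLaw (fun ω => W ω i l) (ISAC.complexGaussian 1) μ)
    (hW_indep : iIndepFun (fun (il : Fin N × Fin L) ω => W ω il.1 il.2) μ)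
    (hsβ : IndepFun s β μ) (hsβW : IndepFun (fun ω => (s ω, β ω)) W μ) :
    ISAC.sensingRate μ p h w s β W = (L : ℝ≥0∞)⁻¹ * ∫⁻ ω, ENNReal.ofReal
      (Real.logb 2 (1 + p * ‖s ω‖ ^ 2 * αs * ‖h‖ ^ 2 * ‖h.ofLp ⬝ᵥ w.ofLp‖ ^ 2)) ∂μ := by
  have hsignal := (ISAC.continuous_signal (L := L) p w).measurable
  have hX : AEMeasurable (fun ω => ISAC.signal p w (s ω)) μ := hsignal.comp_aemeasurable hs_meas
  have hWlaw := ISAC.hasLaw_gaussianMatrix hW hW_indep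
  have hβW : IndepFun β W μ := hsβW.comp measurable_snd measurable_id
  have hXβW : IndepFun (fun ω => ISAC.signal p w (s ω)) (fun ω => (β ω, W ω)) μ :=
    (ISAC.indepFun_prodMk_right hs_meas hβ.aemeasurable hWlaw.aemeasurable hsβ hsβW).comp
      hsignal measurable_id
  have hsnr : ∀ ω, αs * ‖vecMulVec h.ofLp h.ofLp * ISAC.signal p w (s ω)‖ ^ 2 =
      p * ‖s ω‖ ^ 2 * αs * ‖h‖ ^ 2 * ‖h.ofLp ⬝ᵥ w.ofLp‖ ^ 2 := fun ω => by
    rw [ISAC.norm_vecMulVec_mul_signal_sq hp]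
    ring
  rw [ISAC.sensingRate, ISAC.condMutualInfo_echo h hX (hβW.hasLaw_prod hβ hWlaw) hXβW]
  simp only [hsnr]

theorem lemma1 {Ω : Type*} [MeasurableSpace Ω] (μ : Measure Ω) [IsProbabilityMeasure μ]
    {N L : ℕ} (p : ℝ) (hp : 0 ≤ p) (αs : ℝ≥0)
    (h w : EuclideanSpace ℂ (Fin N)) (hw : ‖w‖ ^ 2 = 1)
    -- the unit-power data stream
    (s : Ω → EuclideanSpace ℂ (Fin L)) (hs_meas : AEMeasurable s μ)
    (hs : ∀ᵐ ω ∂μ, (L : ℝ)⁻¹ * ‖s ω‖ ^ 2 = 1)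
    -- the target amplitude
    (β : Ω → ℂ) (hβ : HasLaw β (ISAC.complexGaussian αs) μ)
    -- the white Gaussian noise matrix: i.i.d. standard complex Gaussian entries
    (W : Ω → Matrix (Fin N) (Fin L) ℂ)
    (hW : ∀ i l, HasLaw (fun ω => W ω i l) (ISAC.complexGaussian 1) μ)
    (hW_indep : iIndepFun (fun (il : Fin N × Fin L) ω => W ω il.1 il.2) μ)
    -- mutual independence of the data stream, the target amplitude and the noise
    (hsβ : IndepFun s β μ) (hsβW : IndepFun (fun ω => (s ω, β ω)) W μ) :
    ISAC.sensingRate μ p h w s β W =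
      ENNReal.ofReal ((1 / (L : ℝ)) *
        Real.logb 2 (1 + p * L * αs * ‖h‖ ^ 2 * ‖h.ofLp ⬝ᵥ w.ofLp‖ ^ 2)) := by
  rw [lemma1_general μ p hp αs h w s hs_meas β hβ W hW hW_indep hsβ hsβW]
  exact ISAC.inv_mul_lintegral_comp_sq_norm_of_unit_power hs
    fun t => Real.logb 2 (1 + p * t * αs * ‖h‖ ^ 2 * ‖h.ofLp ⬝ᵥ w.ofLp‖ ^ 2)
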